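/- Let $(\Omega,\nu)$ be an atomless standard Borel probability space and let $W:\Omega\times\Omega\to[0,1]$ be a graphon, i.e. a symmetric measurable function. A measurable set $A\subseteq\Omega$ is *independent* in $W$ if $W=0$ almost everywhere on $A\times A$. A *fractional clique* of $W$ is a measurable function $f:\Omega\to[0,\infty)$ with $\int_I f\,d\nu\le 1$ for every independent set $I$ of $W$, and $\omega_{\mathrm{frac}}(W)\in[0,\infty]$ is the supremum of $\int_\Omega f\,d\nu$ over all fractional cliques $f$ of $W$. For a finite simple graph $G$, a fractional clique of $G$ is a function $f:V(G)\to[0,\infty)$ with $\sum_{v\in I}f(v)\le 1$ for every independent set $I$ of $G$, and $\omega_{\mathrm{frac}}(G)$ is the maximum of $\sum_{v\in V(G)}f(v)$ over all fractional cliques $f$ of $G$. Finally let $$t(G,W)=\int_{\Omega^{V(G)}}\ \prod_{uv\in E(G)}W(x_u,x_v)\ \prod_{v\in V(G)}d\nu(x_v).$$ Then $$\omega_{\mathrm{frac}}(W)=\sup\{\omega_{\mathrm{frac}}(G): G \text{ a finite graph with } t(G,W)>0\},$$ where both sides may be $+\infty$. -/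

import Mathlib

open MeasureTheory
open scoped NNReal ENNReal

/-- A graphon on `Ω`: a symmetric measurable function `Ω × Ω → [0, 1]`. -/
structure Graphon (Ω : Type*) [MeasurableSpace Ω] where
  /-- The underlying two-variable function. -/
  toFun : Ω → Ω → ℝ
  measurable' : Measurable (Function.uncurry toFun)
  symm' : ∀ x y, toFun x y = toFun y x
  mem_Icc' : ∀ x y, toFun x y ∈ Set.Icc (0 : ℝ) 1

namespace FiniteGraph

variable {V : Type*} [Fintype V]

/-- A function `f : V → [0, ∞)` is a fractional clique of the finite graph `G` if its total weight
on every independent set of `G` is at most `1`. -/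
def IsFracClique (G : SimpleGraph V) (f : V → ℝ≥0) : Prop :=
  ∀ I : Finset V, G.IsIndepSet (I : Set V) → ∑ v ∈ I, f v ≤ 1

/-- The fractional clique number of a finite graph: the largest total weight of a fractional
clique. -/
noncomputable def fracCliqueNum (G : SimpleGraph V) : ℝ≥0∞ :=
  ⨆ (f : V → ℝ≥0) (_ : IsFracClique G f), ((∑ v, f v : ℝ≥0) : ℝ≥0∞)

end FiniteGraph

namespace Graphon

variable {Ω : Type*} [MeasurableSpace Ω]

/-- The value of `W` on the unordered pair of the points that `x` assigns to the ends of `e`. -/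
def onEdge (W : Graphon Ω) {V : Type*} (x : V → Ω) (e : Sym2 V) : ℝ :=
  Sym2.lift ⟨fun u v => W.toFun (x u) (x v), fun u v => W.symm' (x u) (x v)⟩ e

open Classical in
/-- The density `t(G, W)` of a finite graph `G` in the graphon `W`, the integral over
`x : V → Ω` (with respect to the product measure) of the product over all edges `uv` of `G`
of `W (x u) (x v)`. -/
noncomputable def density (ν : Measure Ω) {V : Type*} [Fintype V]
    (G : SimpleGraph V) (W : Graphon Ω) : ℝ :=
  ∫ x : V → Ω, ∏ e ∈ G.edgeFinset, W.onEdge x e ∂(Measure.pi fun _ => ν)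

/-- A measurable set `A` is independent in `W` if `W` is zero almost everywhere on `A × A`. -/
def IsIndepSet (ν : Measure Ω) (W : Graphon Ω) (A : Set Ω) : Prop :=
  MeasurableSet A ∧ ∀ᵐ p ∂((ν.prod ν).restrict (A ×ˢ A)), W.toFun p.1 p.2 = 0

/-- A measurable function `f : Ω → [0, ∞)` is a fractional clique of `W` if its integral over every
independent set of `W` is at most `1`. -/
def IsFracClique (ν : Measure Ω) (W : Graphon Ω) (f : Ω → ℝ≥0) : Prop :=
  Measurable f ∧ ∀ I : Set Ω, IsIndepSet ν W I → ∫⁻ x in I, (f x : ℝ≥0∞) ∂ν ≤ 1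

/-- The fractional clique number of `W`, the supremum in `[0, ∞]` of the integrals of its
fractional cliques. -/
noncomputable def fracCliqueNum (ν : Measure Ω) (W : Graphon Ω) : ℝ≥0∞ :=
  ⨆ (f : Ω → ℝ≥0) (_ : IsFracClique ν W f), ∫⁻ x, (f x : ℝ≥0∞) ∂ν

end Graphon

/-! ### Boxes and finite partitions in product spaces -/

namespace MeasureTheory

variable {Ω : Type*} [MeasurableSpace Ω]

open ProbabilityTheory Set

/-! If t(G,W) > 0, the maps V → Ω that carry edges of G into the support of W have positive measure,
so they nearly fill some box ∏ B_v (`exists_lt_pi_cond`). Spreading a fractional clique of G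
uniformly over the B_v gives almost a fractional clique of W, since the vertices v for which an
independent set occupies more than a small fraction of B_v are independent in G.

Conversely, let the simple function s satisfy the clique inequalities of W. By compactness
(`exists_prod_le_imp_lintegral_le`), every measure m ≤ ν whose square gives the support little mass
has ∫ s dm barely above 1. Write ν as a sum of light pieces a_v l_v adapted to a step approximation
of the support, and sample one point from each l_v (`exists_sample_notMem`). For some sample, every
independent set J of the sampled graph makes ∑_{v ∈ J} a_v l_v such a measure m, so the weights a_v
∫ s dl_v form almost a fractional clique, of total ∫ s dν. Almost every sampled graph has positive
density. -/

theorem Measure.pi_cond {V : Type*} [Fintype V] (ν : Measure Ω) [IsProbabilityMeasure ν]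
    {B : V → Set Ω} (hB : ∀ v, MeasurableSet (B v)) (h0 : ∀ v, ν (B v) ≠ 0) :
    Measure.pi (fun v => ν[|B v]) =
      (∏ v, ν (B v))⁻¹ • (Measure.pi fun _ : V => ν).restrict (univ.pi B) := by
  have : ∀ v, IsProbabilityMeasure (ν[|B v]) := fun v => cond_isProbabilityMeasure (h0 v)
  refine Measure.pi_eq fun s hs => ?_
  rw [Measure.smul_apply, Measure.restrict_apply (MeasurableSet.univ_pi hs), ← pi_inter_distrib,
    Measure.pi_pi, smul_eq_mul,
    ENNReal.prod_inv_distrib (s := Finset.univ) (f := fun v => ν (B v))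
      (fun i _ j _ _ => Or.inr (measure_ne_top _ _)),
    ← Finset.prod_mul_distrib]
  refine Finset.prod_congr rfl fun v _ => ?_
  rw [cond_apply (hB v), inter_comm]

theorem Measure.pi_cond_absolutelyContinuous {V : Type*} [Fintype V] (ν : Measure Ω)
    [IsProbabilityMeasure ν] {B : V → Set Ω} (hB : ∀ v, MeasurableSet (B v))
    (h0 : ∀ v, ν (B v) ≠ 0) :
    Measure.pi (fun v => ν[|B v]) ≪ Measure.pi fun _ : V => ν := by
  rw [Measure.pi_cond ν hB h0]
  exact (Measure.absolutelyContinuous_of_le Measure.restrict_le_self).smul_left _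

/-- A set of positive measure in a finite product nearly fills some box. -/
theorem exists_lt_pi_cond {V : Type*} [Fintype V] (ν : Measure Ω) [IsProbabilityMeasure ν]
    {S : Set (V → Ω)} (hS : MeasurableSet S) (hS0 : Measure.pi (fun _ : V => ν) S ≠ 0)
    {c : ℝ≥0∞} (hc : c < 1) :
    ∃ B : V → Set Ω, (∀ v, MeasurableSet (B v)) ∧ (∀ v, ν (B v) ≠ 0) ∧
      c < Measure.pi (fun v => ν[|B v]) S := by
  -- The argument divides by d, and c may be 0.
  obtain ⟨d, hcd, hd⟩ := exists_between hc
  have hd0 : d ≠ 0 := (bot_le.trans_lt hcd).ne'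
  have hdt : d ≠ ∞ := (hd.trans ENNReal.one_lt_top).ne
  by_contra! hcon
  set μ := Measure.pi (fun _ : V => ν) with hμ
  have key : ∀ B : V → Set Ω, (∀ v, MeasurableSet (B v)) →
      d⁻¹ * μ (univ.pi B ∩ S) ≤ ∏ v, ν (B v) := by
    intro B hB
    by_cases h0 : ∀ v, ν (B v) ≠ 0
    · have h := hcon B hB h0
      have hp : ∏ v, ν (B v) ≠ 0 := Finset.prod_ne_zero_iff.2 fun v _ => h0 v
      have hpt : ∏ v, ν (B v) ≠ ∞ := ENNReal.prod_ne_top fun v _ => measure_ne_top _ _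
      rw [Measure.pi_cond ν hB h0, Measure.smul_apply, Measure.restrict_apply hS, smul_eq_mul,
        inter_comm, ENNReal.inv_mul_le_iff hp hpt] at h
      rw [ENNReal.inv_mul_le_iff hd0 hdt, mul_comm]
      exact h.trans (by gcongr)
    · have : μ (univ.pi B) = 0 := by
        push Not at h0
        obtain ⟨v, hv⟩ := h0
        rw [hμ, Measure.pi_pi]
        exact Finset.prod_eq_zero (Finset.mem_univ v) hv
      rw [measure_mono_null inter_subset_left this]
      simp
  -- The bound on boxes passes to the outer measure that they generate; at S it reads μ S ≤ d μ S,
  -- which is absurd.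
  have hle : (d⁻¹ • μ.restrict S).toOuterMeasure ≤
      OuterMeasure.pi fun _ : V => ν.toOuterMeasure := by
    refine OuterMeasure.le_pi.2 fun s _ => ?_
    have h1 := key (fun v => toMeasurable ν (s v)) fun v => measurableSet_toMeasurable _ _
    simp only [measure_toMeasurable] at h1
    refine le_trans ?_ h1
    simp only [Measure.coe_toOuterMeasure, Measure.smul_apply, smul_eq_mul]
    rw [Measure.restrict_apply' hS]
    gcongr
    exact subset_toMeasurable _ _
  have h2 := hle S
  rw [Measure.coe_toOuterMeasure, Measure.smul_apply, Measure.restrict_apply_self,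
    smul_eq_mul] at h2
  have h3 : OuterMeasure.pi (fun _ : V => ν.toOuterMeasure) S = μ S := by
    rw [hμ, Measure.pi, toMeasure_apply _ _ hS]
  rw [h3, ENNReal.inv_mul_le_iff hd0 hdt] at h2
  have h4 : d * μ S < 1 * μ S := ENNReal.mul_lt_mul_left hS0 (measure_ne_top _ _) hd
  rw [one_mul] at h4
  exact absurd h2 h4.not_ge

theorem pi_pair_apply {V : Type*} [Fintype V] (l : V → Measure Ω)
    [∀ v, IsProbabilityMeasure (l v)] {u v : V} (huv : u ≠ v) {E : Set (Ω × Ω)}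
    (hE : MeasurableSet E) :
    Measure.pi l {x | (x u, x v) ∈ E} = ((l u).prod (l v)) E := by
  have h := (iIndepFun_pi (X := fun (_ : V) (ω : Ω) => ω) (μ := l)
    fun _ => aemeasurable_id).indepFun huv
  rw [indepFun_iff_map_prod_eq_prod_map_map (measurable_pi_apply u).aemeasurable
    (measurable_pi_apply v).aemeasurable] at h
  have e : ∀ w, (Measure.pi l).map (fun x => x w) = l w :=
    fun w => (measurePreserving_eval l w).map_eq
  rw [e, e] at h
  rw [← h, Measure.map_apply (by fun_prop) hE]
  rfl

/-- Measurable subsets of a product are approximated by unions of cells of a finite partition. -/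
theorem exists_fin_measure_symmDiff_lt (μ : Measure (Ω × Ω)) [IsFiniteMeasure μ]
    {D : Set (Ω × Ω)} (hD : MeasurableSet D) {ε : ℝ≥0∞} (hε : 0 < ε) :
    ∃ (m : ℕ) (φ : Ω → Fin m) (R : Set (Fin m × Fin m)), Measurable φ ∧
      μ (symmDiff (Prod.map φ φ ⁻¹' R) D) < ε := by
  -- An algebra, by common refinement of partitions; it contains the rectangles, which generate the
  -- product σ-algebra.
  let C : Set (Set (Ω × Ω)) := {E | ∃ (m : ℕ) (φ : Ω → Fin m) (R : Set (Fin m × Fin m)),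
    Measurable φ ∧ E = Prod.map φ φ ⁻¹' R}
  have hC : IsSetAlgebra C := by
    refine ⟨⟨1, fun _ => 0, ∅, measurable_const, by simp⟩, ?_, ?_⟩
    · rintro _ ⟨m, φ, R, hφ, rfl⟩
      exact ⟨m, φ, Rᶜ, hφ, by simp⟩
    · rintro _ _ ⟨m, φ, R, hφ, rfl⟩ ⟨n, ψ, T, hψ, rfl⟩
      refine ⟨m * n, fun x => finProdFinEquiv (φ x, ψ x),
        {p | ((finProdFinEquiv.symm p.1).1, (finProdFinEquiv.symm p.2).1) ∈ R ∨
          ((finProdFinEquiv.symm p.1).2, (finProdFinEquiv.symm p.2).2) ∈ T}, ?_, ?_⟩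
      · exact (measurable_of_countable _).comp (hφ.prodMk hψ)
      · ext p
        simp only [mem_union, mem_preimage, Prod.map_apply', mem_ofPred_eq,
          Equiv.symm_apply_apply]
  have hCm : ∀ E ∈ C, MeasurableSet E := by
    rintro _ ⟨m, φ, R, hφ, rfl⟩
    exact (hφ.prodMap hφ) (Set.toFinite R).measurableSet
  have hgen : (inferInstance : MeasurableSpace (Ω × Ω)) = MeasurableSpace.generateFrom C := by
    refine le_antisymm ?_ (MeasurableSpace.generateFrom_le hCm)
    rw [← generateFrom_prod]
    refine MeasurableSpace.generateFrom_le ?_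
    rintro _ ⟨A, hA, B, hB, rfl⟩
    refine MeasurableSpace.measurableSet_generateFrom ?_
    classical
    refine ⟨2 * 2, fun x => finProdFinEquiv (if x ∈ A then 1 else 0, if x ∈ B then 1 else 0),
      {p | (finProdFinEquiv.symm p.1).1 = 1 ∧ (finProdFinEquiv.symm p.2).2 = 1}, ?_, ?_⟩
    · exact (measurable_of_countable _).comp
        ((Measurable.ite hA measurable_const measurable_const).prodMk
          (Measurable.ite hB measurable_const measurable_const))
    · ext p
      simp
  obtain ⟨E, ⟨m, φ, R, hφ, rfl⟩, hE⟩ := exists_measure_symmDiff_lt_of_generateFrom_isSetRing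
    (μ := μ) hC.isSetRing ⟨{univ}, countable_singleton _, by simpa using hC.univ_mem, by simp⟩ hgen hD hε
  exact ⟨m, φ, R, hφ, hE⟩

end MeasureTheory

/-! ### Setwise limits of measures and compactness -/

namespace MeasureTheory

variable {Ω : Type*} [MeasurableSpace Ω]

open Set Filter Topology

/-- Setwise compactness of the measures below a finite measure. -/
theorem exists_le_tendsto_hyperfilter (ν : Measure Ω) [IsFiniteMeasure ν] (m : ℕ → Measure Ω)
    (hm : ∀ k, m k ≤ ν) :
    ∃ μ ≤ ν, ∀ A, MeasurableSet A → Tendsto (fun k => m k A) (hyperfilter ℕ) (𝓝 (μ A)) := by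
  have hlim : ∀ A, ∃ l, Tendsto (fun k => m k A) (hyperfilter ℕ) (𝓝 l) := fun A =>
    ⟨((hyperfilter ℕ).map fun k => m k A).lim, Ultrafilter.le_nhds_lim _⟩
  choose L hL using hlim
  have hLν : ∀ A, L A ≤ ν A := fun A => le_of_tendsto' (hL A) fun k => hm k A
  have h0 : L ∅ = 0 := le_antisymm ((hLν ∅).trans_eq measure_empty) bot_le
  have hU : ∀ ⦃f : ℕ → Set Ω⦄, (∀ i, MeasurableSet (f i)) → Pairwise (Function.onFun Disjoint f) →
      L (⋃ i, f i) = ∑' i, L (f i) := by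
    intro f hf hd
    -- The tail bound by ν is uniform in k, which preserves countable additivity in the limit.
    have hk : ∀ n k, m k (⋃ i, f i) ≤ ∑ i ∈ Finset.range n, m k (f i) + ν (⋃ i ≥ n, f i) := by
      intro n k
      calc m k (⋃ i, f i) ≤ m k ((⋃ i ∈ Finset.range n, f i) ∪ ⋃ i ≥ n, f i) := by
            refine measure_mono (iUnion_subset fun i => ?_)
            rcases lt_or_ge i n with h | h
            · exact subset_union_of_subset_left
                (subset_biUnion_of_mem (u := f) (by simpa using h)) _
            · exact subset_union_of_subset_right (subset_biUnion_of_mem (u := f) h) _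
        _ ≤ _ := (measure_union_le _ _).trans
            (add_le_add (measure_biUnion_finset_le _ _) (hm k _))
    have hk' : ∀ n k, ∑ i ∈ Finset.range n, m k (f i) ≤ m k (⋃ i, f i) := by
      intro n k
      rw [← measure_biUnion_finset (fun i _ j _ hij => hd hij) fun i _ => hf i]
      exact measure_mono (iUnion₂_subset fun i _ => subset_iUnion f i)
    have hs : ∀ n, Tendsto (fun k => ∑ i ∈ Finset.range n, m k (f i)) (hyperfilter ℕ)
        (𝓝 (∑ i ∈ Finset.range n, L (f i))) := fun n => tendsto_finsetSum _ fun i _ => hL (f i)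
    refine le_antisymm ?_ (ENNReal.tsum_le_of_sum_range_le fun n =>
      le_of_tendsto_of_tendsto' (hs n) (hL _) (hk' n))
    have h1 : ∀ n, L (⋃ i, f i) ≤ ∑' i, L (f i) + ν (⋃ i ≥ n, f i) := fun n =>
      (le_of_tendsto_of_tendsto' (hL _) ((hs n).add_const _) (hk n)).trans
        (by gcongr; exact ENNReal.sum_le_tsum _)
    have h2 : Tendsto (fun n => ν (⋃ i ≥ n, f i)) atTop (𝓝 0) :=
      tendsto_measure_biUnion_Ici_zero_of_pairwise_disjoint
        (fun i => (hf i).nullMeasurableSet) hd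
    have h3 := (tendsto_const_nhds (x := ∑' i, L (f i))).add h2
    rw [add_zero] at h3
    exact ge_of_tendsto' h3 h1
  have hμ : ∀ A, MeasurableSet A →
      Measure.ofMeasurable (fun A _ => L A) h0 (fun f hf hd => hU hf hd) A = L A :=
    fun A hA => Measure.ofMeasurable_apply A hA
  refine ⟨Measure.ofMeasurable (fun A _ => L A) h0 (fun f hf hd => hU hf hd), ?_, ?_⟩
  · refine Measure.le_iff.2 fun A hA => ?_
    rw [hμ A hA]
    exact hLν A
  · intro A hA
    rw [hμ A hA]
    exact hL A

/-- The value is a polynomial in the cell measures, so setwise convergence passes to squares of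
measures on such sets. -/
theorem prod_self_preimage_prodMap {ι : Type*} [Fintype ι] [MeasurableSpace ι]
    [MeasurableSingletonClass ι] (μ : Measure Ω) [SFinite μ] {φ : Ω → ι} (hφ : Measurable φ)
    (R : Finset (ι × ι)) :
    (μ.prod μ) (Prod.map φ φ ⁻¹' R) = ∑ p ∈ R, μ (φ ⁻¹' {p.1}) * μ (φ ⁻¹' {p.2}) := by
  have : Prod.map φ φ ⁻¹' (R : Set (ι × ι)) =
      ⋃ p ∈ R, (φ ⁻¹' {p.1}) ×ˢ (φ ⁻¹' {p.2}) := by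
    ext ⟨x, y⟩
    simp
  rw [this, measure_biUnion_finset]
  · exact Finset.sum_congr rfl fun p _ => Measure.prod_prod _ _
  · intro p _ q _ hpq
    rw [Function.onFun, Set.disjoint_left]
    rintro ⟨x, y⟩ ⟨h1, h2⟩ ⟨h3, h4⟩
    simp only [mem_preimage, mem_singleton_iff] at h1 h2 h3 h4
    exact hpq (Prod.ext (h1.symm.trans h3) (h2.symm.trans h4))
  · exact fun p _ => (hφ (measurableSet_singleton _)).prod (hφ (measurableSet_singleton _))

theorem SimpleFunc.tendsto_lintegral_of_tendsto_measure {α : Type*} {l : Filter α}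
    {m : α → Measure Ω} {μ : Measure Ω}
    (h : ∀ A, MeasurableSet A → Tendsto (fun k => m k A) l (𝓝 (μ A))) (s : SimpleFunc Ω ℝ≥0) :
    Tendsto (fun k => ∫⁻ x, s x ∂(m k)) l (𝓝 (∫⁻ x, s x ∂μ)) := by
  have e : ∀ μ : Measure Ω, ∫⁻ x, s x ∂μ =
      ∑ a ∈ (s.map ((↑) : ℝ≥0 → ℝ≥0∞)).range, a * μ (s.map ((↑) : ℝ≥0 → ℝ≥0∞) ⁻¹' {a}) := by
    intro μ
    exact SimpleFunc.lintegral_eq_lintegral (s.map ((↑) : ℝ≥0 → ℝ≥0∞)) μ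
  simp only [e]
  refine tendsto_finsetSum _ fun a ha => ENNReal.Tendsto.const_mul
    (h _ (SimpleFunc.measurableSet_preimage _ _)) (Or.inr ?_)
  rw [SimpleFunc.mem_range] at ha
  obtain ⟨x, rfl⟩ := ha
  simp

/-- Take for I the set where dμ/dν does not vanish. -/
theorem Measure.exists_restrict_absolutelyContinuous {μ ν : Measure Ω} [SigmaFinite μ]
    [SigmaFinite ν] (h : μ ≪ ν) :
    ∃ I, MeasurableSet I ∧ μ Iᶜ = 0 ∧ ν.restrict I ≪ μ := by
  have hw := Measure.withDensity_rnDeriv_eq μ ν h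
  have hmeas := Measure.measurable_rnDeriv μ ν
  have hI : MeasurableSet {x | μ.rnDeriv ν x ≠ 0} := (hmeas (measurableSet_singleton 0)).compl
  refine ⟨{x | μ.rnDeriv ν x ≠ 0}, hI, ?_, ?_⟩
  · rw [← hw, withDensity_apply_eq_zero hmeas, hw, inter_compl_self, measure_empty]
  · refine Measure.AbsolutelyContinuous.mk fun t ht h0 => ?_
    rw [← hw, withDensity_apply_eq_zero hmeas, inter_comm] at h0
    rwa [Measure.restrict_apply ht]

/-- Counterexamples with η → 0 would have a setwise limit μ ≤ ν with (μ × μ)(D) = 0. The set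
carrying μ then satisfies the hypothesis on I, so ∫ s dμ ≤ 1, although every counterexample exceeds
c > 1. -/
theorem exists_prod_le_imp_lintegral_le (ν : Measure Ω) [IsFiniteMeasure ν]
    {D : Set (Ω × Ω)} (hD : MeasurableSet D) (s : SimpleFunc Ω ℝ≥0)
    (hs : ∀ I, MeasurableSet I → (ν.prod ν) (D ∩ I ×ˢ I) = 0 → ∫⁻ x in I, s x ∂ν ≤ 1)
    {c : ℝ≥0∞} (hc : 1 < c) :
    ∃ η > 0, ∀ m ≤ ν, (m.prod m) D ≤ η → ∫⁻ x, s x ∂m ≤ c := by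
  by_contra! hcon
  have hpos : ∀ k : ℕ, (0 : ℝ≥0∞) < ((k : ℝ≥0∞) + 1)⁻¹ := fun k =>
    ENNReal.inv_pos.2 (by simp)
  choose m hmν hmD hmc using fun k : ℕ => hcon _ (hpos k)
  obtain ⟨μ, hμν, hμ⟩ := exists_le_tendsto_hyperfilter ν m hmν
  have : IsFiniteMeasure μ := isFiniteMeasure_of_le ν hμν
  have hmf : ∀ k, IsFiniteMeasure (m k) := fun k => isFiniteMeasure_of_le ν (hmν k)
  have hinv : Tendsto (fun k : ℕ => ((k : ℝ≥0∞) + 1)⁻¹) (hyperfilter ℕ) (𝓝 0) := by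
    have h := ENNReal.tendsto_inv_nat_nhds_zero.comp (tendsto_add_atTop_nat 1)
    refine (Tendsto.mono_left ?_ Nat.hyperfilter_le_atTop)
    simpa [Function.comp_def] using h
  have hμD : (μ.prod μ) D = 0 := by
    refine le_antisymm (le_of_forall_pos_le_add fun ε hε => ?_) bot_le
    -- Setwise limits control unions of cells; the error in passing to D is uniform, as all the
    -- squares lie below `ν.prod ν`.
    obtain ⟨n, φ, R, hφ, hR⟩ :=
      exists_fin_measure_symmDiff_lt (ν.prod ν) hD (ENNReal.half_pos hε.ne')
    classical
    lift R to Finset (Fin n × Fin n) using R.toFinite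
    set E := Prod.map φ φ ⁻¹' (R : Set (Fin n × Fin n)) with hE
    have hsymm : ∀ m ≤ ν, SFinite m → (m.prod m) (symmDiff E D) ≤ ε / 2 := fun m hm _ =>
      (Measure.prod_mono hm hm _).trans hR.le
    have hED : ∀ k, (m k).prod (m k) E ≤ ((k : ℝ≥0∞) + 1)⁻¹ + ε / 2 := fun k =>
      calc (m k).prod (m k) E ≤ (m k).prod (m k) (D ∪ symmDiff E D) :=
            measure_mono fun p hp => by
              by_cases h : p ∈ D
              · exact Or.inl h
              · exact Or.inr (Or.inl ⟨hp, h⟩)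
        _ ≤ _ := (measure_union_le _ _).trans (add_le_add (hmD k) (hsymm _ (hmν k) inferInstance))
    have hlim : Tendsto (fun k => (m k).prod (m k) E) (hyperfilter ℕ) (𝓝 ((μ.prod μ) E)) := by
      simp only [hE, prod_self_preimage_prodMap _ hφ]
      exact tendsto_finsetSum _ fun p _ => ENNReal.Tendsto.mul
        (hμ _ (hφ (measurableSet_singleton _))) (Or.inr (measure_ne_top _ _))
        (hμ _ (hφ (measurableSet_singleton _))) (Or.inr (measure_ne_top _ _))
    have h1 : (μ.prod μ) E ≤ ε / 2 := by
      simpa using le_of_tendsto_of_tendsto' hlim (hinv.add_const (ε / 2)) hED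
    calc (μ.prod μ) D ≤ (μ.prod μ) (E ∪ symmDiff E D) := measure_mono fun p hp => by
            by_cases h : p ∈ E
            · exact Or.inl h
            · exact Or.inr (Or.inr ⟨hp, h⟩)
      _ ≤ ε / 2 + ε / 2 := (measure_union_le _ _).trans (add_le_add h1 (hsymm μ hμν inferInstance))
      _ = 0 + ε := by rw [ENNReal.add_halves, zero_add]
  obtain ⟨I, hI, hIc, hac⟩ := Measure.exists_restrict_absolutelyContinuous
    (Measure.absolutelyContinuous_of_le hμν)
  have hind : (ν.prod ν) (D ∩ I ×ˢ I) = 0 := by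
    rw [← Measure.restrict_apply hD, ← Measure.prod_restrict]
    exact (hac.prod hac) hμD
  have h1 : ∫⁻ x, s x ∂μ ≤ 1 := by
    rw [← lintegral_add_compl _ hI, Measure.restrict_eq_zero.2 hIc, lintegral_zero_measure,
      add_zero]
    exact (lintegral_mono' (Measure.restrict_mono subset_rfl hμν) le_rfl).trans (hs I hI hind)
  exact absurd (ge_of_tendsto' (SimpleFunc.tendsto_lintegral_of_tendsto_measure hμ s)
    fun k => (hmc k).le) (h1.trans_lt hc).not_ge

end MeasureTheory

/-! ### Mixtures of measures and random samples -/

namespace MeasureTheory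

variable {Ω : Type*} [MeasurableSpace Ω]

open ProbabilityTheory Set

theorem prod_self_apply_of_eq_sum {V : Type*} {J : Finset V} {c : V → ℝ≥0∞} {l : V → Measure Ω}
    [∀ v, SFinite (l v)] {m : Measure Ω} [SFinite m] (hm : m = ∑ v ∈ J, c v • l v)
    {E : Set (Ω × Ω)} (hE : MeasurableSet E) :
    (m.prod m) E = ∑ u ∈ J, ∑ v ∈ J, c u * c v * ((l u).prod (l v)) E := by
  have h : ∀ x, m (Prod.mk x ⁻¹' E) = ∑ v ∈ J, c v * l v (Prod.mk x ⁻¹' E) := by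
    intro x
    simp [hm]
  rw [Measure.prod_apply hE]
  simp only [h]
  rw [lintegral_finsetSum _ fun v _ => (measurable_measure_prodMk_left hE).const_mul _]
  simp_rw [lintegral_const_mul _ (measurable_measure_prodMk_left hE)]
  rw [Finset.sum_comm]
  refine Finset.sum_congr rfl fun v _ => ?_
  rw [hm, lintegral_finsetSum_measure, Finset.mul_sum]
  refine Finset.sum_congr rfl fun u _ => ?_
  rw [lintegral_smul_measure, Measure.prod_apply hE, smul_eq_mul]
  ring

/-- Up to a null set, `symmDiff R D` is D or its complement, and the other factor is at most 1. -/
theorem measure_mul_measure_compl_le_symmDiff {α : Type*} [MeasurableSpace α] (μ : Measure α)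
    [IsProbabilityMeasure μ] {R D : Set α} (h : μ R = 0 ∨ μ Rᶜ = 0) :
    μ D * μ Dᶜ ≤ μ (symmDiff R D) := by
  rcases h with h | h
  · calc μ D * μ Dᶜ ≤ μ D * 1 := by gcongr; exact prob_le_one
      _ ≤ μ (R ∪ symmDiff R D) := by
        rw [mul_one]
        refine measure_mono fun x hx => ?_
        by_cases h : x ∈ R
        · exact Or.inl h
        · exact Or.inr (Or.inr ⟨hx, h⟩)
      _ ≤ _ := (measure_union_le _ _).trans (by rw [h, zero_add])
  · calc μ D * μ Dᶜ ≤ 1 * μ Dᶜ := by gcongr; exact prob_le_one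
      _ ≤ μ (Rᶜ ∪ symmDiff R D) := by
        rw [one_mul]
        refine measure_mono fun x hx => ?_
        by_cases h : x ∈ R
        · exact Or.inr (Or.inl ⟨h, hx⟩)
        · exact Or.inl h
      _ ≤ _ := (measure_union_le _ _).trans (by rw [h, zero_add])

open Classical in
/-- If `ν` is a mixture of the laws `l v`, and the pair laws do not split `R`, then some sample
misses `D` only on pairs of small total mass in `D`. -/
theorem exists_sample_notMem {V : Type*} [Fintype V] {ν : Measure Ω} [SFinite ν]
    {c : V → ℝ≥0∞} {l : V → Measure Ω} [∀ v, IsProbabilityMeasure (l v)]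
    (hν : ν = ∑ v, c v • l v) {D R : Set (Ω × Ω)} (hD : MeasurableSet D) (hR : MeasurableSet R)
    (hlR : ∀ u v, c u ≠ 0 → c v ≠ 0 → (l u).prod (l v) R = 0 ∨ (l u).prod (l v) Rᶜ = 0)
    {N : Set (V → Ω)} (hN : Measure.pi l N = 0) :
    ∃ x ∉ N, ∑ u, ∑ v, (if u ≠ v ∧ (x u, x v) ∉ D then c u * c v * ((l u).prod (l v)) D else 0) ≤
      (ν.prod ν) (symmDiff R D) := by
  have hset : ∀ u v : V, MeasurableSet {x : V → Ω | u ≠ v ∧ (x u, x v) ∉ D} := fun u v =>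
    (MeasurableSet.const _).inter
      (hD.compl.preimage ((measurable_pi_apply u).prodMk (measurable_pi_apply v)))
  have hmeas : ∀ u v : V, Measurable fun x : V → Ω =>
      if u ≠ v ∧ (x u, x v) ∉ D then c u * c v * ((l u).prod (l v)) D else 0 := fun u v =>
    Measurable.ite (hset u v) measurable_const measurable_const
  -- First moment method: some sample outside N does not exceed the mean. For u ≠ v the points x u
  -- and x v are independent, so the mean of a term is c u * c v times the product of the
  -- probabilities of D and Dᶜ.
  obtain ⟨x, hx, hle⟩ := exists_notMem_null_le_lintegral (μ := Measure.pi l)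
    (f := fun x => ∑ u, ∑ v,
      (if u ≠ v ∧ (x u, x v) ∉ D then c u * c v * ((l u).prod (l v)) D else 0))
    (Finset.measurable_sum _ fun u _ => Finset.measurable_sum _ fun v _ => hmeas u v).aemeasurable
    hN
  refine ⟨x, hx, hle.trans ?_⟩
  rw [prod_self_apply_of_eq_sum hν (hR.symmDiff hD),
    lintegral_finsetSum _ fun u _ => Finset.measurable_sum _ fun v _ => hmeas u v]
  refine Finset.sum_le_sum fun u _ => ?_
  rw [lintegral_finsetSum _ fun v _ => hmeas u v]
  refine Finset.sum_le_sum fun v _ => ?_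
  have hi : (fun x : V → Ω =>
      if u ≠ v ∧ (x u, x v) ∉ D then c u * c v * ((l u).prod (l v)) D else 0) =
      {x : V → Ω | u ≠ v ∧ (x u, x v) ∉ D}.indicator
        fun _ => c u * c v * ((l u).prod (l v)) D := by
    ext x
    simp [indicator_apply]
  rw [hi, lintegral_indicator_const (hset u v)]
  by_cases huv : u = v
  · simp [huv]
  by_cases hu : c u = 0
  · simp [hu]
  by_cases hv : c v = 0
  · simp [hv]
  have hpair := pi_pair_apply l huv hD.compl
  simp only [mem_compl_iff] at hpair
  simp only [ne_eq, huv, not_false_eq_true, true_and, hpair]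
  rw [mul_assoc]
  gcongr
  exact measure_mul_measure_compl_le_symmDiff _ (hlR u v hu hv)

/-- Splitting the cells of a finite partition into `k` equal parts writes a probability measure as
a mixture of conditional measures with small weights. -/
theorem exists_eq_sum_smul_cond (ν : Measure Ω) [IsProbabilityMeasure ν] {m : ℕ} {φ : Ω → Fin m}
    (hφ : Measurable φ) {k : ℕ} (hk : k ≠ 0) :
    ∃ (n : ℕ) (i : Fin n → Fin m) (c : Fin n → ℝ≥0∞) (B : Fin n → Set Ω),
      (∀ v, MeasurableSet (B v)) ∧ (∀ v, ν (B v) ≠ 0) ∧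
      (∀ v, c v ≠ 0 → B v = φ ⁻¹' {i v}) ∧ (∀ v, c v ≤ (k : ℝ≥0∞)⁻¹) ∧
      ν = ∑ v, c v • ν[|B v] := by
  classical
  have hP : ∀ j, MeasurableSet (φ ⁻¹' {j}) := fun j => hφ (measurableSet_singleton j)
  -- A null cell gets weight 0; the default `univ` keeps its conditional law a probability measure.
  let Q : Fin m → Set Ω := fun j => if ν (φ ⁻¹' {j}) = 0 then univ else φ ⁻¹' {j}
  let i : Fin (m * k) → Fin m := fun v => (finProdFinEquiv.symm v).1
  -- A cell is not cut: its k parts are k copies of its conditional law, each with 1/k of its mass.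
  refine ⟨m * k, i, fun v => ν (φ ⁻¹' {i v}) * (k : ℝ≥0∞)⁻¹, fun v => Q (i v), ?_, ?_, ?_, ?_, ?_⟩
  · intro v
    by_cases h : ν (φ ⁻¹' {i v}) = 0
    · simp [Q, h]
    · simpa [Q, h] using hP _
  · intro v
    by_cases h : ν (φ ⁻¹' {i v}) = 0
    · simp [Q, h]
    · simp [Q, h]
  · intro v hv
    have : ν (φ ⁻¹' {i v}) ≠ 0 := left_ne_zero_of_mul hv
    simp [Q, this]
  · intro v
    calc ν (φ ⁻¹' {i v}) * (k : ℝ≥0∞)⁻¹ ≤ 1 * (k : ℝ≥0∞)⁻¹ := by gcongr; exact prob_le_one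
      _ = _ := one_mul _
  · ext A hA
    have hterm : ∀ j, ν (φ ⁻¹' {j}) * ν[A | Q j] = ν (φ ⁻¹' {j} ∩ A) := by
      intro j
      by_cases h : ν (φ ⁻¹' {j}) = 0
      · rw [h, zero_mul, measure_mono_null inter_subset_left h]
      · have hQ : Q j = φ ⁻¹' {j} := by simp [Q, h]
        rw [hQ, cond_apply (hP j), ← mul_assoc, ENNReal.mul_inv_cancel h (measure_ne_top _ _),
          one_mul]
    have hk0 : (k : ℝ≥0∞) ≠ 0 := by exact_mod_cast hk
    simp only [Measure.coe_finsetSum, Finset.sum_apply, Measure.smul_apply, smul_eq_mul]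
    rw [← finProdFinEquiv.sum_comp, Fintype.sum_prod_type]
    simp only [i, Equiv.symm_apply_apply, Finset.sum_const, Finset.card_univ, Fintype.card_fin,
      nsmul_eq_mul]
    have : ∀ j, (k : ℝ≥0∞) * (ν (φ ⁻¹' {j}) * (k : ℝ≥0∞)⁻¹ * ν[A | Q j]) = ν (φ ⁻¹' {j} ∩ A) := by
      intro j
      rw [← hterm j]
      calc _ = ((k : ℝ≥0∞) * (k : ℝ≥0∞)⁻¹) * (ν (φ ⁻¹' {j}) * ν[A | Q j]) := by ring
        _ = _ := by rw [ENNReal.mul_inv_cancel hk0 (ENNReal.natCast_ne_top k), one_mul]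
    simp only [this]
    have hU : A = ⋃ j, φ ⁻¹' {j} ∩ A := by
      ext x
      simp
    conv_lhs => rw [hU]
    rw [measure_iUnion _ fun j => (hP j).inter hA, tsum_fintype]
    intro j j' hj
    refine Set.disjoint_left.2 ?_
    rintro x ⟨h1, -⟩ ⟨h2, -⟩
    exact hj (h1.symm.trans h2)

end MeasureTheory

theorem ENNReal.le_of_forall_one_lt_le_mul {a b : ℝ≥0∞}
    (h : ∀ c : ℝ≥0, 1 < c → a ≤ c * b) : a ≤ b := by
  have ht : Filter.Tendsto (fun c : ℝ≥0 => (c : ℝ≥0∞) * b) (nhdsWithin 1 (Set.Ioi 1))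
      (nhds (((1 : ℝ≥0) : ℝ≥0∞) * b)) :=
    ENNReal.Tendsto.mul_const
      ((ENNReal.continuous_coe.tendsto 1).mono_left nhdsWithin_le_nhds) (Or.inl (by simp))
  rw [ENNReal.coe_one, one_mul] at ht
  exact ge_of_tendsto ht (eventually_nhdsWithin_of_forall fun c hc => h c hc)

/-! ### Graphons: the two inequalities -/

namespace Graphon

variable {Ω : Type*} [MeasurableSpace Ω]

open ProbabilityTheory

/-- The set where a graphon does not vanish. -/
def support (W : Graphon Ω) : Set (Ω × Ω) := {p | W.toFun p.1 p.2 ≠ 0}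

theorem measurableSet_support (W : Graphon Ω) : MeasurableSet W.support :=
  (W.measurable' (measurableSet_singleton 0)).compl

theorem isIndepSet_iff (ν : Measure Ω) [SFinite ν] (W : Graphon Ω) {A : Set Ω} :
    IsIndepSet ν W A ↔ MeasurableSet A ∧ (ν.prod ν) (W.support ∩ A ×ˢ A) = 0 := by
  rw [IsIndepSet, ae_iff]
  refine and_congr_right fun _ => ?_
  change (ν.prod ν).restrict (A ×ˢ A) W.support = 0 ↔ _
  rw [Measure.restrict_apply W.measurableSet_support]

/-- The maps `V → Ω` sending every edge of `G` to a pair where `W` does not vanish. -/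
def homSet (W : Graphon Ω) {V : Type*} (G : SimpleGraph V) : Set (V → Ω) :=
  {x | ∀ u v, G.Adj u v → (x u, x v) ∈ W.support}

theorem measurableSet_homSet (W : Graphon Ω) {V : Type*} [Fintype V] (G : SimpleGraph V) :
    MeasurableSet (W.homSet G) := by
  have : W.homSet G = ⋂ (u) (v) (_ : G.Adj u v), (fun x : V → Ω => (x u, x v)) ⁻¹' W.support := by
    ext x
    simp [homSet]
  rw [this]
  exact .iInter fun u => .iInter fun v => .iInter fun _ =>
    W.measurableSet_support.preimage ((measurable_pi_apply u).prodMk (measurable_pi_apply v))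

theorem onEdge_mem_Icc (W : Graphon Ω) {V : Type*} (x : V → Ω) (e : Sym2 V) :
    W.onEdge x e ∈ Set.Icc (0 : ℝ) 1 := by
  induction e with
  | _ u v => exact W.mem_Icc' (x u) (x v)

theorem measurable_onEdge (W : Graphon Ω) {V : Type*} (e : Sym2 V) :
    Measurable fun x : V → Ω => W.onEdge x e := by
  induction e with
  | _ u v =>
    exact W.measurable'.comp (f := fun x : V → Ω => (x u, x v))
      ((measurable_pi_apply u).prodMk (measurable_pi_apply v))

theorem density_pos_iff (ν : Measure Ω) [IsProbabilityMeasure ν] (W : Graphon Ω) {V : Type*}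
    [Fintype V] (G : SimpleGraph V) :
    0 < density ν G W ↔ Measure.pi (fun _ : V => ν) (W.homSet G) ≠ 0 := by
  classical
  have h0 : ∀ x : V → Ω, 0 ≤ ∏ e ∈ G.edgeFinset, W.onEdge x e := fun x =>
    Finset.prod_nonneg fun e _ => (W.onEdge_mem_Icc x e).1
  have hint : Integrable (fun x : V → Ω => ∏ e ∈ G.edgeFinset, W.onEdge x e)
      (Measure.pi fun _ => ν) := by
    refine Integrable.of_bound (Finset.measurable_prod _ fun e _ =>
      W.measurable_onEdge e).aestronglyMeasurable 1 (Filter.Eventually.of_forall fun x => ?_)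
    rw [Real.norm_of_nonneg (h0 x)]
    exact Finset.prod_le_one (fun e _ => (W.onEdge_mem_Icc x e).1)
      fun e _ => (W.onEdge_mem_Icc x e).2
  have hsupp : Function.support (fun x : V → Ω => ∏ e ∈ G.edgeFinset, W.onEdge x e) =
      W.homSet G := by
    ext x
    simp only [Function.mem_support, Finset.prod_ne_zero_iff, SimpleGraph.mem_edgeFinset]
    exact ⟨fun h u v huv => h s(u, v) huv, fun h e => by
      induction e with
      | _ u v => exact fun huv => h u v huv⟩
  have := integral_pos_iff_support_of_nonneg (μ := Measure.pi fun _ : V => ν) h0 hint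
  rw [hsupp, pos_iff_ne_zero (a := Measure.pi (fun _ : V => ν) (W.homSet G))] at this
  rw [← this, density]

theorem fracCliqueNum_le_of_density_pos (ν : Measure Ω) [IsProbabilityMeasure ν] (W : Graphon Ω)
    {V : Type*} [Fintype V] {G : SimpleGraph V} (hG : 0 < density ν G W) :
    FiniteGraph.fracCliqueNum G ≤ fracCliqueNum ν W := by
  classical
  refine iSup₂_le fun w hw => ENNReal.le_of_forall_one_lt_le_mul fun c hc => ?_
  set T : ℝ≥0 := ∑ v, w v with hT
  have hc0 : c ≠ 0 := (zero_lt_one.trans hc).ne'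
  -- Vertices with `ν[I | B v]` at most θ will cost at most θT in total, and θ² bounds the fraction
  -- of the box missed by `homSet`.
  obtain ⟨θ, hθ, hθc⟩ : ∃ θ : ℝ≥0, 0 < θ ∧ 1 + θ * T ≤ c := by
    refine ⟨(c - 1) / (T + 1), div_pos (tsub_pos_of_lt hc) (by positivity), ?_⟩
    have h1 : (c - 1) / (T + 1) * T ≤ c - 1 := by
      rw [div_mul_eq_mul_div]
      refine div_le_of_le_mul₀ (by positivity) (by positivity) ?_
      gcongr
      exact le_self_add
    calc 1 + (c - 1) / (T + 1) * T ≤ 1 + (c - 1) := by gcongr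
      _ = c := add_tsub_cancel_of_le hc.le
  have hθ2 : (1 : ℝ≥0∞) - (θ * θ : ℝ≥0) < 1 :=
    ENNReal.sub_lt_self ENNReal.one_ne_top one_ne_zero (by simpa using hθ.ne')
  obtain ⟨B, hB, hB0, hlt⟩ := exists_lt_pi_cond ν (W.measurableSet_homSet G)
    ((density_pos_iff ν W G).1 hG) hθ2
  have hl : ∀ v, IsProbabilityMeasure (ν[|B v]) := fun v => cond_isProbabilityMeasure (hB0 v)
  have hcompl : Measure.pi (fun v => ν[|B v]) (W.homSet G)ᶜ ≤ (θ * θ : ℝ≥0) := by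
    rw [prob_compl_eq_one_sub (W.measurableSet_homSet G)]
    exact tsub_le_iff_tsub_le.1 hlt.le
  have hedge : ∀ I, IsIndepSet ν W I → ∀ u v, G.Adj u v →
      ν[I | B u] * ν[I | B v] ≤ (θ * θ : ℝ≥0) := by
    intro I hI u v huv
    rw [isIndepSet_iff] at hI
    have hsub : {x : V → Ω | (x u, x v) ∈ W.supportᶜ} ⊆ (W.homSet G)ᶜ :=
      fun x hx hx' => hx (hx' u v huv)
    calc ν[I | B u] * ν[I | B v] = ((ν[|B u]).prod (ν[|B v])) (I ×ˢ I) :=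
          (Measure.prod_prod _ _).symm
      _ ≤ ((ν[|B u]).prod (ν[|B v])) (W.supportᶜ ∪ W.support ∩ I ×ˢ I) :=
          measure_mono fun p hp => by
            by_cases h : p ∈ W.support
            · exact Or.inr ⟨h, hp⟩
            · exact Or.inl h
      _ ≤ ((ν[|B u]).prod (ν[|B v])) W.supportᶜ + 0 :=
          (measure_union_le _ _).trans (add_le_add le_rfl
            ((cond_absolutelyContinuous.prod cond_absolutelyContinuous) hI.2).le)
      _ = Measure.pi (fun v => ν[|B v]) {x | (x u, x v) ∈ W.supportᶜ} := by
          rw [add_zero, pi_pair_apply _ huv.ne W.measurableSet_support.compl]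
      _ ≤ _ := (measure_mono hsub).trans hcompl
  set f : Ω → ℝ≥0 := fun x => ∑ v, (B v).indicator
    (fun _ => c⁻¹ * w v * (ν (B v)).toNNReal⁻¹) x with hf
  have hfm : Measurable f := Finset.measurable_sum _ fun v _ => measurable_const.indicator (hB v)
  have hfint : ∀ I, MeasurableSet I →
      ∫⁻ x in I, f x ∂ν = (c⁻¹ : ℝ≥0) * ∑ v, w v * ν[I | B v] := by
    intro I hI
    simp only [hf, ENNReal.ofNNReal_finsetSum, ENNReal.coe_indicator]
    rw [lintegral_finsetSum _ fun v _ => measurable_const.indicator (hB v), Finset.mul_sum]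
    refine Finset.sum_congr rfl fun v _ => ?_
    have h0 : (ν (B v)).toNNReal ≠ 0 := by
      simpa [ENNReal.toNNReal_eq_zero_iff] using hB0 v
    rw [lintegral_indicator_const (hB v), Measure.restrict_apply (hB v), cond_apply (hB v),
      ENNReal.coe_mul, ENNReal.coe_mul, ENNReal.coe_inv h0,
      ENNReal.coe_toNNReal (measure_ne_top _ _)]
    ring
  have hclique : IsFracClique ν W f := by
    refine ⟨hfm, fun I hI => ?_⟩
    rw [hfint I hI.1, ENNReal.coe_inv hc0, ENNReal.inv_mul_le_iff (by simpa) ENNReal.coe_ne_top,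
      mul_one]
    -- By `hedge`, adjacent vertices cannot both exceed θ.
    let J : Finset V := Finset.univ.filter fun v => (θ : ℝ≥0∞) < ν[I | B v]
    have hJ : G.IsIndepSet (J : Set V) := by
      intro u hu v hv _ huv
      simp only [J, Finset.coe_filter, Finset.mem_univ, true_and, Set.mem_ofPred_eq] at hu hv
      have := ENNReal.mul_lt_mul hu hv
      rw [← ENNReal.coe_mul] at this
      exact absurd (hedge I hI u v huv) this.not_ge
    calc ∑ v, (w v : ℝ≥0∞) * ν[I | B v]
        ≤ ∑ v, ((if v ∈ J then (w v : ℝ≥0∞) else 0) + θ * w v) := by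
          refine Finset.sum_le_sum fun v _ => ?_
          by_cases hv : v ∈ J
          · rw [if_pos hv]
            calc (w v : ℝ≥0∞) * ν[I | B v] ≤ w v * 1 := by gcongr; exact prob_le_one
              _ ≤ _ := by rw [mul_one]; exact le_self_add
          · rw [if_neg hv, zero_add, mul_comm]
            gcongr
            simpa [J] using hv
      _ = ((∑ v ∈ J, w v + θ * T : ℝ≥0) : ℝ≥0∞) := by
          rw [Finset.sum_add_distrib, ← Finset.mul_sum, hT]
          push_cast
          simp
      _ ≤ c := by
          refine ENNReal.coe_le_coe.2 (le_trans ?_ hθc)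
          gcongr
          exact hw J hJ
  have htot : ∫⁻ x, f x ∂ν = (c⁻¹ : ℝ≥0) * (T : ℝ≥0∞) := by
    have := hfint Set.univ MeasurableSet.univ
    simp only [measure_univ, mul_one, Measure.restrict_univ] at this
    rw [this, hT, ENNReal.ofNNReal_finsetSum]
  calc (T : ℝ≥0∞) = c * ∫⁻ x, f x ∂ν := by
        rw [htot, ← mul_assoc, ← ENNReal.coe_mul, mul_inv_cancel₀ hc0, ENNReal.coe_one, one_mul]
    _ ≤ c * fracCliqueNum ν W := by
        gcongr
        exact le_iSup₂_of_le f hclique le_rfl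

/-- The graph of the pairs of sampled points where `W` does not vanish. -/
def sampleGraph (W : Graphon Ω) {V : Type*} (x : V → Ω) : SimpleGraph V where
  Adj u v := u ≠ v ∧ (x u, x v) ∈ W.support
  symm := ⟨fun u v h => ⟨h.1.symm, fun h0 => h.2 ((W.symm' (x u) (x v)).trans h0)⟩⟩
  loopless := ⟨fun _ h => h.1 rfl⟩

/-- Each x lies in the `homSet` of its own sample graph, and only finitely many graphs on V occur;
those of zero density have null `homSet`. -/
theorem measure_density_sampleGraph_eq_zero (ν : Measure Ω) [IsProbabilityMeasure ν]
    (W : Graphon Ω) {V : Type*} [Fintype V] :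
    Measure.pi (fun _ : V => ν) {x | ¬ 0 < density ν (W.sampleGraph x) W} = 0 := by
  refine measure_mono_null (t := ⋃ (G : SimpleGraph V) (_ : ¬ 0 < density ν G W), W.homSet G) ?_ ?_
  · intro x hx
    exact Set.mem_iUnion₂.2 ⟨W.sampleGraph x, hx, fun u v h => h.2⟩
  · refine measure_iUnion_null fun G => measure_iUnion_null fun hG => ?_
    rwa [density_pos_iff, not_not] at hG

theorem lintegral_simpleFunc_le (ν : Measure Ω) [IsProbabilityMeasure ν] (W : Graphon Ω)
    (s : SimpleFunc Ω ℝ≥0) (hs : ∀ I, IsIndepSet ν W I → ∫⁻ x in I, s x ∂ν ≤ 1) :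
    ∫⁻ x, s x ∂ν ≤ ⨆ (n : ℕ) (G : SimpleGraph (Fin n)) (_ : 0 < density ν G W),
      FiniteGraph.fracCliqueNum G := by
  classical
  refine ENNReal.le_of_forall_one_lt_le_mul fun c hc => ?_
  have hc0 : c ≠ 0 := (zero_lt_one.trans hc).ne'
  obtain ⟨η, hη, hcomp⟩ := exists_prod_le_imp_lintegral_le ν W.measurableSet_support s
    (fun I hI h => hs I ((isIndepSet_iff ν W).2 ⟨hI, h⟩)) (c := c) (by exact_mod_cast hc)
  -- Half of η pays for the step approximation, half for the diagonal pairs u = v.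
  obtain ⟨m, φ, R, hφ, hR⟩ := exists_fin_measure_symmDiff_lt (ν.prod ν) W.measurableSet_support
    (ENNReal.half_pos hη.ne')
  obtain ⟨k, hk⟩ := ENNReal.exists_inv_nat_lt (ENNReal.half_pos hη.ne').ne'
  have hk0 : k ≠ 0 := by
    rintro rfl
    simp at hk
  obtain ⟨n, i, a, B, hB, hB0, hBi, hak, hν⟩ := exists_eq_sum_smul_cond ν hφ hk0
  set l : Fin n → Measure Ω := fun v => ν[|B v] with hl
  have hlp : ∀ v, IsProbabilityMeasure (l v) := fun v => cond_isProbabilityMeasure (hB0 v)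
  have hsum : ∑ v, a v = 1 := by
    have := congrArg (fun μ : Measure Ω => μ Set.univ) hν
    simpa using this.symm
  obtain ⟨x, hx, hxle⟩ := exists_sample_notMem hν W.measurableSet_support
    (hφ.prodMap hφ R.toFinite.measurableSet) (fun u v hu hv => by
      have hcell : (l u).prod (l v) ((φ ⁻¹' {i u}) ×ˢ (φ ⁻¹' {i v}))ᶜ = 0 := by
        rw [prob_compl_eq_zero_iff ((hφ (measurableSet_singleton _)).prod
          (hφ (measurableSet_singleton _))), Measure.prod_prod, hl, ← hBi u hu, ← hBi v hv,
          cond_apply_self (hB0 u) (measure_ne_top _ _),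
          cond_apply_self (hB0 v) (measure_ne_top _ _), one_mul]
      by_cases h : (i u, i v) ∈ R
      · refine Or.inr (measure_mono_null ?_ hcell)
        rintro ⟨y, z⟩ hyz ⟨h1, h2⟩
        simp only [Set.mem_preimage, Set.mem_singleton_iff] at h1 h2
        refine hyz ?_
        simpa [h1, h2] using h
      · refine Or.inl (measure_mono_null ?_ hcell)
        rintro ⟨y, z⟩ hyz ⟨h1, h2⟩
        simp only [Set.mem_preimage, Set.mem_singleton_iff] at h1 h2
        refine h ?_
        simpa [h1, h2] using hyz)
    (Measure.pi_cond_absolutelyContinuous ν hB hB0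
      (measure_density_sampleGraph_eq_zero ν W (V := Fin n)))
  have hdens : 0 < density ν (W.sampleGraph x) W := not_not.1 hx
  have hsfin : ∫⁻ y, s y ∂ν ≠ ∞ := by
    have := SimpleFunc.lintegral_eq_lintegral (s.map ((↑) : ℝ≥0 → ℝ≥0∞)) ν
    simp only [SimpleFunc.coe_map, Function.comp_apply] at this
    rw [this, SimpleFunc.lintegral]
    refine ENNReal.sum_ne_top.2 fun b hb => ENNReal.mul_ne_top ?_ (measure_ne_top _ _)
    rw [SimpleFunc.mem_range] at hb
    obtain ⟨y, rfl⟩ := hb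
    simp
  have hint : ∀ J : Finset (Fin n), ∫⁻ y, s y ∂(∑ v ∈ J, a v • l v) =
      ∑ v ∈ J, a v * ∫⁻ y, s y ∂(l v) := by
    intro J
    rw [lintegral_finsetSum_measure]
    simp [lintegral_smul_measure]
  have htotal : ∫⁻ y, s y ∂ν = ∑ v, a v * ∫⁻ y, s y ∂(l v) := by
    rw [← hint, ← hν]
  have hwfin : ∀ v, a v * ∫⁻ y, s y ∂(l v) ≠ ∞ := fun v =>
    ENNReal.sum_ne_top.1 (htotal ▸ hsfin) v (Finset.mem_univ v)
  lift (fun v => a v * ∫⁻ y, s y ∂(l v)) to Fin n → ℝ≥0 using hwfin with w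
  have hclique : FiniteGraph.IsFracClique (W.sampleGraph x) fun v => c⁻¹ * w v := by
    intro J hJ
    have hle : ∑ v ∈ J, a v • l v ≤ ν := by
      refine Measure.le_iff'.2 fun A => ?_
      conv_rhs => rw [hν]
      simp only [Measure.coe_finsetSum, Finset.sum_apply]
      exact Finset.sum_le_sum_of_subset (Finset.subset_univ J)
    have : IsFiniteMeasure (∑ v ∈ J, a v • l v) := isFiniteMeasure_of_le ν hle
    have henergy : ((∑ v ∈ J, a v • l v).prod (∑ v ∈ J, a v • l v)) W.support ≤ η := by
      rw [prod_self_apply_of_eq_sum rfl W.measurableSet_support]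
      calc ∑ u ∈ J, ∑ v ∈ J, a u * a v * ((l u).prod (l v)) W.support
          ≤ ∑ u ∈ J, ∑ v ∈ J, ((if u ≠ v ∧ (x u, x v) ∉ W.support then
              a u * a v * ((l u).prod (l v)) W.support else 0) +
              if u = v then a u * (k : ℝ≥0∞)⁻¹ else 0) := by
            refine Finset.sum_le_sum fun u hu => Finset.sum_le_sum fun v hv => ?_
            -- The sample says nothing about u = v; since each weight is at most 1/k and the weights
            -- sum to 1, these pairs contribute at most 1/k.
            by_cases huv : u = v
            · subst huv
              simp only [ne_eq, not_true_eq_false, false_and, if_false, if_true, zero_add]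
              calc a u * a u * _ ≤ a u * a u * 1 := by gcongr; exact prob_le_one
                _ ≤ _ := by rw [mul_one]; gcongr; exact hak u
            · have : (x u, x v) ∉ W.support := fun h => hJ hu hv huv ⟨huv, h⟩
              simp [huv, this]
        _ ≤ ∑ u, ∑ v, ((if u ≠ v ∧ (x u, x v) ∉ W.support then
              a u * a v * ((l u).prod (l v)) W.support else 0) +
              if u = v then a u * (k : ℝ≥0∞)⁻¹ else 0) :=
            (Finset.sum_le_sum fun u _ =>
              Finset.sum_le_sum_of_subset (Finset.subset_univ J)).trans
              (Finset.sum_le_sum_of_subset (Finset.subset_univ J))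
        _ ≤ η / 2 + η / 2 := by
            simp only [Finset.sum_add_distrib]
            refine add_le_add ((le_of_eq ?_).trans (hxle.trans hR.le)) ?_
            · congr!
            simp only [Finset.sum_ite_eq, Finset.mem_univ, if_true]
            rw [← Finset.sum_mul, hsum, one_mul]
            exact hk.le
        _ = η := ENNReal.add_halves η
    have h := hcomp _ hle henergy
    rw [hint] at h
    rw [← ENNReal.ofNNReal_finsetSum, ENNReal.coe_le_coe] at h
    rw [← Finset.mul_sum, inv_mul_le_iff₀ (pos_iff_ne_zero.2 hc0), mul_one]
    exact h
  calc ∫⁻ y, s y ∂ν = ((∑ v, w v : ℝ≥0) : ℝ≥0∞) := by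
        rw [htotal, ENNReal.ofNNReal_finsetSum]
    _ = c * ((∑ v, c⁻¹ * w v : ℝ≥0) : ℝ≥0∞) := by
        rw [← ENNReal.coe_mul, ← Finset.mul_sum, mul_inv_cancel_left₀ hc0]
    _ ≤ c * FiniteGraph.fracCliqueNum (W.sampleGraph x) := by
        gcongr
        exact le_iSup₂_of_le (fun v => c⁻¹ * w v) hclique le_rfl
    _ ≤ _ := by
        gcongr
        exact le_iSup_of_le n (le_iSup₂_of_le (W.sampleGraph x) hdens le_rfl)

end Graphon

theorem corollary5 {Ω : Type*} [MeasurableSpace Ω] [StandardBorelSpace Ω]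
    (ν : Measure Ω) [IsProbabilityMeasure ν] [NullSingletonClass ν] (W : Graphon Ω) :
    Graphon.fracCliqueNum ν W =
      ⨆ (n : ℕ) (G : SimpleGraph (Fin n)) (_ : 0 < Graphon.density ν G W),
        FiniteGraph.fracCliqueNum G := by
  refine le_antisymm (iSup₂_le fun f hf => ?_)
    (iSup_le fun n => iSup₂_le fun G hG => Graphon.fracCliqueNum_le_of_density_pos ν W hG)
  -- The compactness argument needs simple functions; those below f inherit its clique inequalities.
  rw [lintegral_eq_nnreal]
  refine iSup₂_le fun s hs => ?_
  rw [← SimpleFunc.lintegral_eq_lintegral]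
  exact Graphon.lintegral_simpleFunc_le ν W s fun I hI =>
    (lintegral_mono hs).trans (hf.2 I hI)
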